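/- A multiplicative lattice is a complete lattice $L$ (with least element $0$ and greatest element $1$) together with a commutative, associative multiplication such that $1$ is the multiplicative identity and $x\bigvee E=\bigvee\{xe\mid e\in E\}$ for all $x\in L$ and $E\subseteq L$. For $a,b\in L$ let $(a:b)=\bigvee\{x\in L\mid xb\le a\}$. An element $e\in L$ is principal if $a\wedge be=((a:e)\wedge b)e$ and $((a\vee be):e)=(a:e)\vee b$ for all $a,b\in L$. An element $a\in L$ is compact if $a\le\bigvee F$ with $F\subseteq L$ implies $a\le\bigvee E$ for some finite $E\subseteq F$. $L$ is a C-lattice if there is a set $C$ of compact elements, containing $1$ and closed under multiplication, such that every element of $L$ is a join of elements of $C$. $L$ is principally generated if every element of $L$ is a join of principal elements. An element $p<1$ is prime if $ab\le p$ implies $a\le p$ or $b\le p$ for all $a,b\in L$. An element $x<1$ is an OA-element ($1$-absorbing prime element) if for all $a,b,c\in L\setminus\{1\}$, $abc\le x$ implies $ab\le x$ or $c\le x$. Finite products may be empty, the empty product being $1$. Theorem 4.14. Let $L$ be a principally generated C-lattice. The following statements are equivalent. (1) $L$ is a ZPI-lattice, that is, every element of $L$ is a finite product of prime elements. (2) $L$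 is a Prüfer OAFL, that is, every compact element of $L$ is principal and every element of $L$ is a finite product of OA-elements. (3) $L$ is a Prüfer POAFL, that is, every compact element of $L$ is principal and every principal element of $L$ is a finite product of OA-elements. -/

import Mathlib

/-- A multiplicative lattice: a complete lattice which is also a commutative monoid, such that
multiplication distributes over arbitrary joins (this is `IsQuantale`) and such that the identity
of the monoid is the greatest element. The least element `0` of the lattice is written `⊥`. -/
class IsMultiplicativeLattice (L : Type*) [CommMonoid L] [CompleteLattice L] : Prop
    extends IsQuantale L where
  one_eq_top : (1 : L) = ⊤

namespace MultLattice

section Defs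

variable {L : Type*} [CommMonoid L] [CompleteLattice L]

/-- The colon `(a : b)`, the join of all `x` with `x * b ≤ a`. -/
def colon (a b : L) : L := sSup {x | x * b ≤ a}

/-- `e` is meet principal: `a ∧ be = ((a : e) ∧ b)e` for all `a, b`. -/
def IsMeetPrincipal (e : L) : Prop :=
  ∀ a b : L, a ⊓ b * e = (colon a e ⊓ b) * e

/-- `e` is join principal: `((a ∨ be) : e) = (a : e) ∨ b` for all `a, b`. -/
def IsJoinPrincipal (e : L) : Prop :=
  ∀ a b : L, colon (a ⊔ b * e) e = colon a e ⊔ b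

/-- `e` is principal: both meet principal and join principal. -/
def IsPrincipalElement (e : L) : Prop :=
  IsMeetPrincipal e ∧ IsJoinPrincipal e

/-- A prime element: a proper element `p` such that `ab ≤ p` implies `a ≤ p` or `b ≤ p`. -/
def IsPrimeElement (p : L) : Prop :=
  p < 1 ∧ ∀ a b : L, a * b ≤ p → a ≤ p ∨ b ≤ p

/-- A 1-absorbing prime element (OA-element): a proper element `x` such that, for all `a, b, c`
different from `1`, `abc ≤ x` implies `ab ≤ x` or `c ≤ x`. -/
def IsOAElement (x : L) : Prop :=
  x < 1 ∧ ∀ a b c : L, a ≠ 1 → b ≠ 1 → c ≠ 1 → a * b * c ≤ x → a * b ≤ x ∨ c ≤ x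

/-- `a` is a finite product of elements satisfying `P`; the element `1` is the empty product. -/
def IsFiniteProductOf (P : L → Prop) (a : L) : Prop :=
  ∃ s : Multiset L, (∀ x ∈ s, P x) ∧ s.prod = a

variable (L)

/-- `L` is a C-lattice: it is generated under joins by a multiplicatively closed set (containing
`1`) of compact elements. -/
def IsCLattice : Prop :=
  ∃ C : Submonoid L, (∀ c ∈ C, IsCompactElement c) ∧
    ∀ a : L, ∃ S : Set L, S ⊆ C ∧ a = sSup S

/-- `L` is principally generated: every element is a join of a set of principal elements. -/
def IsPrincipallyGenerated : Prop :=
  ∀ a : L, ∃ S : Set L, (∀ x ∈ S, IsPrincipalElement x) ∧ a = sSup S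

/-- `L` is a Prüfer lattice: every compact element is principal. -/
def IsPruferLattice : Prop :=
  ∀ a : L, IsCompactElement a → IsPrincipalElement a

/-- `L` is a ZPI-lattice: every element is a finite product of prime elements. -/
def IsZPILattice : Prop :=
  ∀ a : L, IsFiniteProductOf IsPrimeElement a

/-- `L` is an OA-factorization lattice: every element is a finite product of OA-elements. -/
def IsOAFL : Prop :=
  ∀ a : L, IsFiniteProductOf IsOAElement a

/-- `L` is a POAFL: every principal element is a finite product of OA-elements. -/
def IsPOAFL : Prop :=
  ∀ a : L, IsPrincipalElement a → IsFiniteProductOf IsOAElement a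

end Defs

end MultLattice

/-!
The lattice is not assumed to be modular, so quotients `L / a` need not be principally generated;
the argument stays inside `L` and works with the localizations `a_M` of its elements (`loc M a`).

Both a ZPI-lattice and a Prüfer POAFL have the property that compact elements are finite products
of primes. For a Prüfer POAFL this holds because a nonprime OA-element `x` forces `L` to have a
greatest element `m ≠ 1` with `m * m ≤ x`; the Prüfer condition makes `m` principal and
`x = m * m` (`IsPruferLattice.isFiniteProductOf_of_isOAElement`).

Given this property, let `M` be a prime which is not locally idempotent, and take a principal
`x ≤ M` that is not locally below `M * M`. Then `x` has just one prime factor `E ≤ M`, and so does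
`x ⊔ y * y` for every principal `y ≤ M`. A prime above `y * y` is above `y`, and join principality
of `y` then gives `y ≤ E`. Hence `M = E` is locally principal, and Nakayama's lemma shows that
the primes strictly below `M` vanish locally (`le_loc_bot_of_not_le_loc`). For primes `P < M` the
factorization of a suitable element `b ⊔ y` with `b ≤ P` supplies a prime `M'` with `P < M' ≤ M`
that is not locally idempotent (`SeparatesPrimes.exists_not_le_loc`). Therefore no chain of three
primes exists and all primes strictly below `M` vanish locally at `M`
(`SeparatesPrimes.le_loc_bot`). Consequently each element is locally `⊥` or a power of `M`
(`exists_isPrincipalElement_le_loc`).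

In a ZPI-lattice, compact elements are thus locally principal, hence principal
(`isPrincipalElement_of_locally`). In a Prüfer POAFL, every element `a` agrees locally with a
compact `b ≤ a` outside the finitely many prime factors of `⊥` and of `b`, and enlarging `b` at those
primes shows that `a` is compact (`isZPILattice_of_forall_isCompactElement`).
-/

namespace MultLattice

/-! ### Finite products and prime elements -/

lemma IsFiniteProductOf.mul {M : Type*} [CommMonoid M] {P : M → Prop} {a b : M}
    (ha : IsFiniteProductOf P a) (hb : IsFiniteProductOf P b) : IsFiniteProductOf P (a * b) := by
  obtain ⟨s, hs, rfl⟩ := ha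
  obtain ⟨t, ht, rfl⟩ := hb
  exact ⟨s + t, fun x hx => (Multiset.mem_add.1 hx).elim (hs x) (ht x), Multiset.prod_add s t⟩

lemma IsFiniteProductOf.of_apply {M : Type*} [CommMonoid M] {P : M → Prop} {a : M}
    (ha : P a) : IsFiniteProductOf P a :=
  ⟨{a}, fun _ hx => Multiset.mem_singleton.1 hx ▸ ha, Multiset.prod_singleton a⟩

lemma IsFiniteProductOf.trans {M : Type*} [CommMonoid M] {P Q : M → Prop} {a : M}
    (ha : IsFiniteProductOf P a) (h : ∀ x, P x → IsFiniteProductOf Q x) : IsFiniteProductOf Q a := by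
  obtain ⟨s, hs, rfl⟩ := ha
  induction s using Multiset.induction with
  | empty => exact ⟨0, by simp, rfl⟩
  | cons a s ih =>
    rw [Multiset.prod_cons]
    exact (h a (hs a (Multiset.mem_cons_self a s))).mul
      (ih fun x hx => hs x (Multiset.mem_cons_of_mem hx))

lemma isCompactElement_sup {L : Type*} [CompleteLattice L] {a b : L} (ha : IsCompactElement a)
    (hb : IsCompactElement b) : IsCompactElement (a ⊔ b) := by
  classical
  have := CompleteLattice.isCompactElement_finsetSup (f := id) ({a, b} : Finset L) (by
    simp [ha, hb])
  simpa using this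

section

variable {L : Type*} [CommMonoid L] [CompleteLattice L]

lemma IsPrimeElement.mul_not_le {p a b : L} (hp : IsPrimeElement p) (ha : ¬ a ≤ p)
    (hb : ¬ b ≤ p) : ¬ a * b ≤ p := fun h => (hp.2 a b h).elim ha hb

lemma IsPrimeElement.one_not_le {p : L} (hp : IsPrimeElement p) : ¬ 1 ≤ p :=
  fun h => hp.1.not_ge h

lemma IsPrimeElement.le_of_mul_le {p a b : L} (hp : IsPrimeElement p) (h : a * b ≤ p)
    (hb : ¬ b ≤ p) : a ≤ p := (hp.2 a b h).resolve_right hb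

lemma IsPrimeElement.exists_mem_le_of_prod_le {p : L} (hp : IsPrimeElement p) {s : Multiset L}
    (h : s.prod ≤ p) : ∃ q ∈ s, q ≤ p := by
  induction s using Multiset.induction with
  | empty => exact absurd (by simpa using h) hp.one_not_le
  | cons a s ih =>
    rw [Multiset.prod_cons] at h
    rcases hp.2 _ _ h with h | h
    · exact ⟨a, Multiset.mem_cons_self a s, h⟩
    · obtain ⟨q, hq, hqp⟩ := ih h
      exact ⟨q, Multiset.mem_cons_of_mem hq, hqp⟩

lemma IsPrimeElement.isOAElement {p : L} (hp : IsPrimeElement p) : IsOAElement p :=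
  ⟨hp.1, fun a b c _ _ _ h => hp.2 (a * b) c h⟩

/-- In a product of primes, the factors lying below a given prime can be split off. -/
lemma IsPrimeElement.exists_factors {M a : L} (hM : IsPrimeElement M)
    (ha : IsFiniteProductOf IsPrimeElement a) :
    ∃ (s : Multiset L) (t : L), (∀ p ∈ s, IsPrimeElement p ∧ p ≤ M) ∧ ¬ t ≤ M ∧
      a = s.prod * t := by
  classical
  obtain ⟨u, hu, rfl⟩ := ha
  refine ⟨u.filter (· ≤ M), (u.filter (¬ · ≤ M)).prod, fun p hp => ?_, fun h => ?_, ?_⟩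
  · rw [Multiset.mem_filter] at hp
    exact ⟨hu p hp.1, hp.2⟩
  · obtain ⟨q, hq, hqM⟩ := hM.exists_mem_le_of_prod_le h
    exact (Multiset.mem_filter.1 hq).2 hqM
  · rw [← Multiset.prod_add, Multiset.filter_add_not]

lemma isCompactElement_one (hC : IsCLattice L) : IsCompactElement (1 : L) := by
  obtain ⟨C, hC, -⟩ := hC
  exact hC 1 C.one_mem

lemma IsPrincipallyGenerated.le_of_forall (hP : IsPrincipallyGenerated L) {a b : L}
    (h : ∀ x, IsPrincipalElement x → x ≤ a → x ≤ b) : a ≤ b := by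
  obtain ⟨S, hS, rfl⟩ := hP a
  exact sSup_le fun x hx => h x (hS x hx) (le_sSup hx)

lemma IsPrincipallyGenerated.exists_not_le (hP : IsPrincipallyGenerated L) {a b : L}
    (h : ¬ a ≤ b) : ∃ x, IsPrincipalElement x ∧ x ≤ a ∧ ¬ x ≤ b := by
  by_contra! hx
  exact h (hP.le_of_forall hx)

/-! ### Localization at a prime element -/

/-- The localization `a_M` of `a` at `M`, considered as an element of the lattice itself: the join
of all `x` with `x * s ≤ a` for some `s` not below `M`. -/
def loc (M a : L) : L := sSup {x | ∃ s, ¬ s ≤ M ∧ x * s ≤ a}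

lemma le_loc_of_mul_le {M a x s : L} (hs : ¬ s ≤ M) (h : x * s ≤ a) : x ≤ loc M a :=
  le_sSup ⟨s, hs, h⟩

lemma loc_mono (M : L) {a b : L} (h : a ≤ b) : loc M a ≤ loc M b :=
  sSup_le fun _ ⟨_, hs, hx⟩ => le_loc_of_mul_le hs (hx.trans h)

lemma IsPrimeElement.le_loc {M : L} (hM : IsPrimeElement M) (a : L) : a ≤ loc M a :=
  le_loc_of_mul_le hM.one_not_le (mul_one a).le

lemma IsPrimeElement.loc_le {M p : L} (hp : IsPrimeElement p) (h : p ≤ M) : loc M p ≤ p :=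
  sSup_le fun _ ⟨_, hs, hx⟩ => hp.le_of_mul_le hx fun hsp => hs (hsp.trans h)

end

variable {L : Type*} [CommMonoid L] [CompleteLattice L] [IsMultiplicativeLattice L]

/-! ### Colons and principal elements -/

lemma le_one' (a : L) : a ≤ 1 :=
  (IsMultiplicativeLattice.one_eq_top (L := L)).symm ▸ le_top

lemma mul_le_left (a b : L) : a * b ≤ a :=
  (mul_le_mul_right (le_one' b) a).trans_eq (mul_one a)

lemma mul_le_right (a b : L) : a * b ≤ b :=
  (mul_le_mul_left (le_one' a) b).trans_eq (one_mul b)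

lemma le_colon_iff {a b x : L} : x ≤ colon a b ↔ x * b ≤ a := by
  refine ⟨fun h => (mul_le_mul_left h b).trans ?_, fun h => le_sSup h⟩
  rw [colon, IsQuantale.sSup_mul_distrib]
  exact iSup₂_le fun y hy => hy

lemma colon_mul_le (a b : L) : colon a b * b ≤ a := le_colon_iff.1 le_rfl

lemma IsMeetPrincipal.eq_colon_mul {e a : L} (he : IsMeetPrincipal e) (h : a ≤ e) :
    colon a e * e = a := by
  have := he a 1
  rw [one_mul, inf_eq_left.2 h, inf_eq_left.2 (le_one' (colon a e))] at this
  exact this.symm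

lemma IsMeetPrincipal.inf_eq {e : L} (he : IsMeetPrincipal e) (a : L) :
    a ⊓ e = colon a e * e := by
  have := he a 1
  rwa [one_mul, inf_eq_left.2 (le_one' (colon a e))] at this

lemma IsPrincipalElement.le_colon_sup {e a b x : L} (he : IsPrincipalElement e)
    (h : x * e ≤ a ⊔ b * e) : x ≤ colon a e ⊔ b := by
  rw [← he.2 a b]
  exact le_colon_iff.2 h

lemma isPrincipalElement_bot : IsPrincipalElement (⊥ : L) := by
  have h (a : L) : colon a ⊥ = 1 :=
    le_antisymm (le_one' _) (le_colon_iff.2 (by rw [one_mul]; exact bot_le))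
  refine ⟨fun a b => by simp [Quantale.mul_bot], fun a b => ?_⟩
  rw [h, h]
  exact (sup_eq_left.2 (le_one' b)).symm

lemma prod_le_of_mem {s : Multiset L} {a : L} (h : a ∈ s) : s.prod ≤ a := by
  obtain ⟨t, rfl⟩ := Multiset.exists_cons_of_mem h
  rw [Multiset.prod_cons]
  exact mul_le_left _ _

/-- A product of primes that lies below the prime `M`, but not below `M * M`, has exactly one
factor below `M`. -/
lemma IsPrimeElement.exists_factor_of_not_le_mul_self {M a : L} (hM : IsPrimeElement M)
    (ha : IsFiniteProductOf IsPrimeElement a) (haM : a ≤ M) (haM' : ¬ a ≤ M * M) :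
    ∃ p t : L, IsPrimeElement p ∧ p ≤ M ∧ ¬ t ≤ M ∧ a = p * t := by
  obtain ⟨s, t, hs, ht, rfl⟩ := hM.exists_factors ha
  obtain ⟨p, hp, hpM⟩ := hM.exists_mem_le_of_prod_le (hM.le_of_mul_le haM ht)
  obtain ⟨s, rfl⟩ := Multiset.exists_cons_of_mem hp
  rcases s.empty_or_exists_mem with rfl | ⟨q, hq⟩
  · exact ⟨p, t, (hs p hp).1, hpM, ht, by simp⟩
  · refine absurd ?_ haM'
    rw [Multiset.prod_cons]
    exact (mul_le_left _ _).trans (mul_le_mul' hpM ((prod_le_of_mem hq).trans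
      (hs q (Multiset.mem_cons_of_mem hq)).2))

/-! ### Compactness -/

lemma exists_le_isPrimeElement (hC : IsCLattice L) {a : L} (ha : a ≠ 1) :
    ∃ M : L, IsPrimeElement M ∧ a ≤ M := by
  have h1 : (1 : L) = ⊤ := IsMultiplicativeLattice.one_eq_top
  have : IsCoatomic L := CompleteLattice.coatomic_of_top_compact (h1 ▸ isCompactElement_one hC)
  obtain ⟨M, hM, haM⟩ := (eq_top_or_exists_le_coatom a).resolve_left (h1 ▸ ha)
  refine ⟨M, ⟨h1 ▸ hM.lt_top, fun x y hxy => or_iff_not_imp_left.2 fun hx => ?_⟩, haM⟩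
  have h : M ⊔ x = 1 := h1 ▸ hM.2 _ (left_lt_sup.2 hx)
  calc y = (M ⊔ x) * y := by rw [h, one_mul]
    _ = M * y ⊔ x * y := Quantale.sup_mul_distrib
    _ ≤ M := sup_le (mul_le_left _ _) hxy

/-- An inequality may be checked locally at every prime element. -/
lemma le_of_forall_isPrimeElement (hC : IsCLattice L) {a b : L}
    (h : ∀ M : L, IsPrimeElement M → ∃ s, ¬ s ≤ M ∧ a * s ≤ b) : a ≤ b := by
  by_contra hab
  have h1 : colon b a ≠ 1 := fun h1 => hab (by simpa [h1] using colon_mul_le b a)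
  obtain ⟨M, hM, hle⟩ := exists_le_isPrimeElement hC h1
  obtain ⟨s, hs, has⟩ := h M hM
  exact hs ((le_colon_iff.2 (by rwa [mul_comm])).trans hle)

lemma IsPrincipalElement.isCompactElement (hC : IsCLattice L) {e : L}
    (he : IsPrincipalElement e) : IsCompactElement e := by
  have hone := isCompactElement_one hC
  obtain ⟨C, hCc, hCg⟩ := hC
  obtain ⟨S, hSC, heS⟩ := hCg e
  rw [CompleteLattice.isCompactElement_iff_le_of_directed_sSup_le] at hone ⊢
  intro D hD hDdir heD
  -- The colons `(d : e)` with `d ∈ D` form a directed set, and their join is `1`.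
  have hle {d : L} (hd : d ∈ D) : colon d e ≤ sSup ((colon · e) '' D) :=
    le_sSup (Set.mem_image_of_mem (colon · e) hd)
  have hcol : (1 : L) ≤ sSup ((colon · e) '' D) := by
    have h : (1 : L) ≤ colon ⊥ e ⊔ sSup ((colon · e) '' D) := by
      apply he.le_colon_sup
      rw [one_mul, bot_sup_eq]
      conv_lhs => rw [heS]
      refine sSup_le fun c hc => ?_
      have hce : c ≤ e := heS ▸ le_sSup hc
      obtain ⟨d, hd, hcd⟩ := (CompleteLattice.isCompactElement_iff_le_of_directed_sSup_le L c).1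
        (hCc c (hSC hc)) D hD hDdir (hce.trans heD)
      calc c = colon c e * e := (he.1.eq_colon_mul hce).symm
        _ ≤ sSup ((colon · e) '' D) * e := mul_le_mul_left
          ((le_colon_iff.2 ((colon_mul_le c e).trans hcd)).trans (hle hd)) e
    refine h.trans (sup_le ?_ le_rfl)
    obtain ⟨d, hd⟩ := hD
    exact (le_colon_iff.2 ((colon_mul_le ⊥ e).trans bot_le)).trans (hle hd)
  obtain ⟨_, ⟨d, hd, rfl⟩, h1⟩ := hone ((colon · e) '' D) (hD.image _) (by
    rintro _ ⟨c, hc, rfl⟩ _ ⟨d, hd, rfl⟩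
    obtain ⟨f, hf, hcf, hdf⟩ := hDdir c hc d hd
    exact ⟨_, ⟨f, hf, rfl⟩, le_colon_iff.2 ((colon_mul_le c e).trans hcf),
      le_colon_iff.2 ((colon_mul_le d e).trans hdf)⟩) hcol
  exact ⟨d, hd, by simpa using le_colon_iff.1 h1⟩

lemma colon_mul (a e f : L) : colon a (e * f) = colon (colon a f) e :=
  eq_of_forall_le_iff fun x => by simp only [le_colon_iff, mul_assoc]

lemma IsPrincipalElement.mul {e f : L} (he : IsPrincipalElement e) (hf : IsPrincipalElement f) :
    IsPrincipalElement (e * f) := by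
  refine ⟨fun a b => ?_, fun a b => ?_⟩
  · rw [← mul_assoc, hf.1, he.1, colon_mul, mul_assoc]
  · rw [colon_mul, ← mul_assoc, hf.2, he.2, colon_mul]

/-! ### Local inequalities and local principality -/

lemma IsPrimeElement.loc_mul_loc_le {M : L} (hM : IsPrimeElement M) (a b : L) :
    loc M a * loc M b ≤ loc M (a * b) := by
  rw [loc, loc, IsQuantale.sSup_mul_distrib]
  refine iSup₂_le fun x ⟨s, hs, hx⟩ => ?_
  rw [IsQuantale.mul_sSup_distrib]
  refine iSup₂_le fun y ⟨t, ht, hy⟩ => le_loc_of_mul_le (hM.mul_not_le hs ht) ?_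
  rw [mul_mul_mul_comm]
  exact mul_le_mul' hx hy

lemma IsPrimeElement.pow_le_loc {M a : L} (hM : IsPrimeElement M) (h : a ≤ loc M (a * a)) (k : ℕ) :
    a ^ k ≤ loc M (a ^ k * a ^ k) := by
  induction k with
  | zero => simpa using hM.le_loc 1
  | succ k ih =>
    rw [pow_succ, mul_mul_mul_comm]
    exact (mul_le_mul' ih h).trans (hM.loc_mul_loc_le _ _)

/-- A compact element lies below `a_M` only if one multiplier outside `M` carries it into `a`. -/
lemma IsPrimeElement.exists_mul_le_of_le_loc {M a z : L} (hM : IsPrimeElement M)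
    (hz : IsCompactElement z) (h : z ≤ loc M a) : ∃ s, ¬ s ≤ M ∧ z * s ≤ a := by
  rw [CompleteLattice.isCompactElement_iff_le_of_directed_sSup_le] at hz
  obtain ⟨x, ⟨s, hs, hx⟩, hzx⟩ := hz {x | ∃ s, ¬ s ≤ M ∧ x * s ≤ a}
    ⟨⊥, 1, hM.one_not_le, by simp⟩ (by
    rintro x ⟨s, hs, hx⟩ y ⟨t, ht, hy⟩
    refine ⟨x ⊔ y, ⟨s * t, hM.mul_not_le hs ht, ?_⟩, le_sup_left, le_sup_right⟩
    rw [Quantale.sup_mul_distrib]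
    refine sup_le ?_ ?_
    · rw [← mul_assoc]
      exact (mul_le_left _ _).trans hx
    · rw [mul_comm s, ← mul_assoc]
      exact (mul_le_left _ _).trans hy) h
  exact ⟨s, hs, (mul_le_mul_left hzx s).trans hx⟩

/-- A compact element that is locally principal at every prime element is principal. -/
lemma isPrincipalElement_of_locally (hC : IsCLattice L) {e : L} (he : IsCompactElement e)
    (h : ∀ M, IsPrimeElement M → ∃ y, IsPrincipalElement y ∧ y ≤ e ∧ e ≤ loc M y) :
    IsPrincipalElement e := by
  have h' : ∀ M, IsPrimeElement M → ∃ y s, IsPrincipalElement y ∧ y ≤ e ∧ ¬ s ≤ M ∧ e * s ≤ y := by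
    intro M hM
    obtain ⟨y, hy, hye, hey⟩ := h M hM
    obtain ⟨s, hs, hes⟩ := hM.exists_mul_le_of_le_loc he hey
    exact ⟨y, s, hy, hye, hs, hes⟩
  -- `e` and `y` have the same colons up to the multiplier `s`
  have hcol {y s : L} (hes : e * s ≤ y) (a : L) : colon a y * s ≤ colon a e := by
    rw [le_colon_iff, mul_assoc, mul_comm s]
    exact (mul_le_mul_right hes _).trans (colon_mul_le a y)
  refine ⟨fun a b => le_antisymm ?_ ?_, fun a b => le_antisymm ?_ ?_⟩
  · refine le_of_forall_isPrimeElement hC fun M hM => ?_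
    obtain ⟨y, s, hy, hye, hs, hes⟩ := h' M hM
    refine ⟨s * s, hM.mul_not_le hs hs, ?_⟩
    have h1 : (a ⊓ b * e) * s ≤ (colon a y ⊓ b) * y := by
      rw [← hy.1]
      refine le_inf ((mul_le_left _ _).trans inf_le_left) ((mul_le_mul_left inf_le_right s).trans ?_)
      rw [mul_assoc]
      exact mul_le_mul_right hes b
    calc (a ⊓ b * e) * (s * s) = (a ⊓ b * e) * s * s := (mul_assoc _ _ _).symm
      _ ≤ (colon a y ⊓ b) * y * s := mul_le_mul_left h1 s
      _ = (colon a y ⊓ b) * s * y := mul_right_comm _ _ _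
      _ ≤ (colon a e ⊓ b) * e := mul_le_mul' (le_inf
        ((mul_le_mul_left inf_le_left s).trans (hcol hes a))
        ((mul_le_left _ _).trans inf_le_right)) hye
  · exact le_inf ((mul_le_mul_left inf_le_left e).trans (colon_mul_le a e))
      (mul_le_mul_left inf_le_right e)
  · refine le_of_forall_isPrimeElement hC fun M hM => ?_
    obtain ⟨y, s, hy, hye, hs, hes⟩ := h' M hM
    refine ⟨s * s, hM.mul_not_le hs hs, ?_⟩
    have h1 : colon (a ⊔ b * e) e * s ≤ colon a y ⊔ b := by
      apply hy.le_colon_sup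
      calc colon (a ⊔ b * e) e * s * y = colon (a ⊔ b * e) e * y * s := mul_right_comm _ _ _
        _ ≤ (a ⊔ b * e) * s := mul_le_mul_left
          ((mul_le_mul_right hye _).trans (colon_mul_le _ _)) s
        _ = a * s ⊔ b * (e * s) := by rw [Quantale.sup_mul_distrib, mul_assoc]
        _ ≤ a ⊔ b * y := sup_le_sup (mul_le_left _ _) (mul_le_mul_right hes b)
    rw [← mul_assoc]
    refine (mul_le_mul_left h1 s).trans ?_
    rw [Quantale.sup_mul_distrib]
    exact sup_le_sup (hcol hes a) (mul_le_left _ _)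
  · refine sup_le (le_colon_iff.2 ((colon_mul_le a e).trans le_sup_left))
      (le_colon_iff.2 le_sup_right)

/-! ### The local structure when compact elements are products of primes -/

/-- If compact elements are products of primes and `M` is not locally idempotent, then `M` is
locally principal. -/
lemma exists_isPrincipalElement_of_not_le_loc (hC : IsCLattice L) (hP : IsPrincipallyGenerated L)
    (hF : ∀ a : L, IsCompactElement a → IsFiniteProductOf IsPrimeElement a) {M : L}
    (hM : IsPrimeElement M) (hMM : ¬ M ≤ loc M (M * M)) :
    ∃ x t, IsPrincipalElement x ∧ x ≤ M ∧ ¬ t ≤ M ∧ M * t ≤ x := by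
  obtain ⟨x, hx, hxM, hxM'⟩ := hP.exists_not_le hMM
  replace hxM' : ¬ x ≤ M * M := fun h => hxM' (h.trans (hM.le_loc _))
  have hxc := hx.isCompactElement hC
  obtain ⟨E, t, hE, hEM, ht, rfl⟩ := hM.exists_factor_of_not_le_mul_self (hF x hxc) hxM hxM'
  refine ⟨E * t, t, hx, hxM, ht, mul_le_mul_left (hP.le_of_forall fun y hy hyM => ?_) t⟩
  by_contra hyE
  -- `x ⊔ y * y` also has a single factor below `M`, and that factor contains `y`.
  obtain ⟨E', t', hE', -, ht', h⟩ := hM.exists_factor_of_not_le_mul_self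
    (hF _ (isCompactElement_sup hxc ((hy.mul hy).isCompactElement hC)))
    (sup_le hxM ((mul_le_left _ _).trans hyM)) (fun h => hxM' (le_sup_left.trans h))
  have hyy : y * y ≤ E' := le_sup_right.trans (h.trans_le (mul_le_left _ _))
  have hyE' : y ≤ E' := (hE'.2 y y hyy).elim id id
  refine ht' ((hy.le_colon_sup (a := E * t) (b := y) ?_).trans (sup_le ?_ hyM))
  · rw [h, mul_comm]
    exact mul_le_mul_left hyE' t'
  · exact (hE.le_of_mul_le ((colon_mul_le _ _).trans (mul_le_left _ _)) hyE).trans hEM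

/-- If compact elements are products of primes and `M` is not locally idempotent, then the primes
strictly below `M` vanish locally at `M`. -/
lemma le_loc_bot_of_not_le_loc (hC : IsCLattice L) (hP : IsPrincipallyGenerated L)
    (hF : ∀ a : L, IsCompactElement a → IsFiniteProductOf IsPrimeElement a) {M Q : L}
    (hM : IsPrimeElement M) (hMM : ¬ M ≤ loc M (M * M)) (hQ : IsPrimeElement Q) (hQM : Q < M) :
    Q ≤ loc M ⊥ := by
  obtain ⟨x, t, hx, hxM, ht, hMt⟩ := exists_isPrincipalElement_of_not_le_loc hC hP hF hM hMM
  refine hP.le_of_forall fun w hw hwQ => ?_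
  obtain ⟨u, hu, hw'⟩ := hF w (hw.isCompactElement hC)
  obtain ⟨E, hEu, hEQ⟩ := hQ.exists_mem_le_of_prod_le (hw'.trans_le hwQ)
  obtain ⟨R, rfl⟩ := Multiset.exists_cons_of_mem hEu
  rw [Multiset.prod_cons] at hw'
  have hE := hu E hEu
  have hxE : ¬ x ≤ E := fun h => hQM.not_ge
    ((hE.le_of_mul_le (hMt.trans h) fun h' => ht (h'.trans (hEQ.trans hQM.le))).trans hEQ)
  -- `x` is locally the same as `M`, so that `E` is locally fixed by multiplication by `x`.
  have hEx : E * t ≤ E * x := by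
    have h : E * t ≤ E ⊓ x :=
      le_inf (mul_le_left _ _) ((mul_le_mul_left (hEQ.trans hQM.le) t).trans hMt)
    rw [hx.1.inf_eq] at h
    exact h.trans (mul_le_mul_left (hE.le_of_mul_le (colon_mul_le E x) hxE) x)
  -- The principal element `w` is therefore annihilated outside `M`, as in Nakayama's lemma.
  have htw : t ≤ colon ⊥ w ⊔ x := by
    apply hw.le_colon_sup
    rw [bot_sup_eq, ← hw', ← mul_assoc, ← mul_assoc, mul_comm t E, mul_comm x E]
    exact mul_le_mul_left hEx _
  refine le_loc_of_mul_le (s := colon ⊥ w) (fun h => ht (htw.trans (sup_le h hxM))) ?_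
  rw [mul_comm]
  exact colon_mul_le _ _

/-- For primes `P < M` there are `b ≤ P` and a principal `y ≤ M`, not below `P`, such that `b ⊔ y`
is a product of primes and the primes between `b ⊔ y` and `M` lie above `P`. ZPI-lattices have this
property with `b = P`, and Prüfer lattices whose compact elements are products of primes have it
with `b = ⊥`. -/
def SeparatesPrimes (L : Type*) [CommMonoid L] [CompleteLattice L] : Prop :=
  ∀ P M : L, IsPrimeElement P → IsPrimeElement M → P < M →
    ∃ b y : L, b ≤ P ∧ IsPrincipalElement y ∧ y ≤ M ∧ ¬ y ≤ P ∧
      IsFiniteProductOf IsPrimeElement (b ⊔ y) ∧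
      ∀ E : L, IsPrimeElement E → b ⊔ y ≤ E → E ≤ M → P ≤ E

/-- A prime `M' ≤ M` minimal over `b ⊔ y` is not locally idempotent: otherwise so would be `b ⊔ y`,
which is locally a power of `M'`, and cancelling `y` would place some `r` not below `M'` below
`P ⊔ y ≤ M'`. -/
lemma SeparatesPrimes.exists_not_le_loc (hC : IsCLattice L) (hS : SeparatesPrimes L) {P M : L}
    (hPp : IsPrimeElement P) (hM : IsPrimeElement M) (hPM : P < M) :
    ∃ M', IsPrimeElement M' ∧ P < M' ∧ M' ≤ M ∧ ¬ M' ≤ loc M' (M' * M') := by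
  obtain ⟨b, y, hbP, hy, hyM, hyP, hby, hE⟩ := hS P M hPp hM hPM
  obtain ⟨u, hu, hprod⟩ := hby
  -- `M'` is a minimal prime over `b ⊔ y`.
  have hfin : {q | q ∈ u ∧ q ≤ M}.Finite := u.finite_toSet.subset fun q hq => hq.1
  obtain ⟨q₀, hq₀, hq₀M⟩ := hM.exists_mem_le_of_prod_le
    (hprod.trans_le (sup_le (hbP.trans hPM.le) hyM))
  obtain ⟨M', ⟨hM'u, hM'M⟩, hmin⟩ := hfin.exists_minimal ⟨q₀, hq₀, hq₀M⟩
  have hM' := hu M' hM'u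
  have hbyM' : b ⊔ y ≤ M' := hprod.symm.trans_le (prod_le_of_mem hM'u)
  have hyM' : y ≤ M' := le_sup_right.trans hbyM'
  have hPM' : P ≤ M' := hE M' hM' hbyM' hM'M
  refine ⟨M', hM', lt_of_le_of_ne hPM' fun h => hyP (h ▸ hyM'), hM'M, fun hidem => ?_⟩
  -- Locally at `M'`, the element `b ⊔ y` is a power of `M'`, which would be idempotent.
  obtain ⟨s, t, hs, ht, hst⟩ := hM'.exists_factors ⟨u, hu, hprod⟩
  have hs' : s.prod = M' ^ s.card := by
    rw [← Multiset.prod_replicate]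
    congr 1
    refine Multiset.eq_replicate_card.2 fun p hp => le_antisymm (hs p hp).2 ?_
    have hbp : u.prod ≤ p :=
      hprod.trans_le (hst.trans_le ((mul_le_left _ _).trans (prod_le_of_mem hp)))
    obtain ⟨q, hq, hqp⟩ := (hs p hp).1.exists_mem_le_of_prod_le hbp
    exact (hmin ⟨hq, hqp.trans ((hs p hp).2.trans hM'M)⟩ (hqp.trans (hs p hp).2)).trans hqp
  rw [hs'] at hst
  obtain ⟨r, hr, hyr⟩ := hM'.exists_mul_le_of_le_loc (hy.isCompactElement hC)
    ((le_sup_right.trans (hst.trans_le (mul_le_left _ _))).trans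
      (hM'.pow_le_loc hidem s.card))
  refine hM'.mul_not_le hr (hM'.mul_not_le ht ht)
    ((hy.le_colon_sup (a := b) (b := y) ?_).trans
      (sup_le ((hPp.le_of_mul_le ((colon_mul_le b y).trans hbP) hyP).trans hPM') hyM'))
  calc r * (t * t) * y = y * r * (t * t) := by rw [mul_comm, mul_assoc]
    _ ≤ M' ^ s.card * M' ^ s.card * (t * t) := mul_le_mul_left hyr _
    _ = (b ⊔ y) * (b ⊔ y) := by rw [mul_mul_mul_comm, ← hst]
    _ ≤ b ⊔ y * y := by
      rw [Quantale.sup_mul_distrib, Quantale.mul_sup_distrib (x := y)]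
      exact sup_le ((mul_le_left _ _).trans le_sup_left)
        (sup_le ((mul_le_right _ _).trans le_sup_left) le_sup_right)

/-- Primes strictly below `M` vanish locally at `M`. In particular there is no chain of three
primes. -/
lemma SeparatesPrimes.le_loc_bot (hC : IsCLattice L) (hP : IsPrincipallyGenerated L)
    (hF : ∀ a : L, IsCompactElement a → IsFiniteProductOf IsPrimeElement a)
    (hS : SeparatesPrimes L) {Q M : L} (hQ : IsPrimeElement Q) (hM : IsPrimeElement M)
    (hQM : Q < M) : Q ≤ loc M ⊥ := by
  obtain ⟨M', hM', hQM', hM'M, hidem⟩ := hS.exists_not_le_loc hC hQ hM hQM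
  rcases hM'M.eq_or_lt with rfl | hlt
  · exact le_loc_bot_of_not_le_loc hC hP hF hM' hidem hQ hQM'
  · obtain ⟨M'', hM'', hlt', -, hidem'⟩ := hS.exists_not_le_loc hC hM' hM hlt
    refine absurd ?_ hQM'.not_ge
    exact (le_loc_bot_of_not_le_loc hC hP hF hM'' hidem' hM' hlt').trans
      ((loc_mono M'' bot_le).trans (hQ.loc_le (hQM'.trans hlt').le))

/-- If the primes strictly below `M` vanish locally at `M`, then every element is locally `⊥` or
a power of `M`, and in particular locally equal to a principal element below it. -/
lemma exists_isPrincipalElement_le_loc (hC : IsCLattice L) (hP : IsPrincipallyGenerated L)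
    (hF : ∀ a : L, IsCompactElement a → IsFiniteProductOf IsPrimeElement a) {M : L}
    (hM : IsPrimeElement M) (hN : ∀ Q : L, IsPrimeElement Q → Q < M → Q ≤ loc M ⊥) (a : L) :
    ∃ y, IsPrincipalElement y ∧ y ≤ a ∧ a ≤ loc M y := by
  have key {w : L} (hw : IsPrincipalElement w) :
      w ≤ loc M ⊥ ∨ ∃ k t, ¬ t ≤ M ∧ w = M ^ k * t := by
    obtain ⟨s, t, hs, ht, hst⟩ := hM.exists_factors (hF w (hw.isCompactElement hC))
    by_cases h : ∀ p ∈ s, p = M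
    · exact Or.inr ⟨s.card, t, ht, by
        rw [hst, ← Multiset.prod_replicate, ← Multiset.eq_replicate_card.2 h]⟩
    · push Not at h
      obtain ⟨p, hp, hpM⟩ := h
      exact Or.inl (hst.trans_le ((mul_le_left _ _).trans ((prod_le_of_mem hp).trans
        (hN p (hs p hp).1 (lt_of_le_of_ne (hs p hp).2 hpM)))))
  by_cases hex : ∃ k t w, IsPrincipalElement w ∧ w ≤ a ∧ ¬ t ≤ M ∧ w = M ^ k * t
  · classical
    obtain ⟨t, w, hw, hwa, ht, hwt⟩ := Nat.find_spec hex
    refine ⟨w, hw, hwa, hP.le_of_forall fun v hv hva => ?_⟩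
    rcases key hv with h | ⟨k, r, hr, hvr⟩
    · exact h.trans (loc_mono M bot_le)
    · refine le_loc_of_mul_le ht ?_
      rw [hwt, hvr]
      exact mul_le_mul_left ((mul_le_left _ _).trans
        (pow_le_pow_right_of_le_one' (le_one' M)
          (Nat.find_min' hex ⟨r, v, hv, hva, hr, hvr⟩))) t
  · refine ⟨⊥, isPrincipalElement_bot, bot_le, hP.le_of_forall fun v hv hva => ?_⟩
    exact (key hv).resolve_right fun ⟨k, t, ht, h⟩ => hex ⟨k, t, v, hv, hva, ht, h⟩

/-- If compact elements are products of primes, and primes strictly below another prime vanish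
locally there, then every element is compact and therefore a product of primes. -/
lemma isZPILattice_of_forall_isCompactElement (hC : IsCLattice L) (hP : IsPrincipallyGenerated L)
    (hF : ∀ a : L, IsCompactElement a → IsFiniteProductOf IsPrimeElement a)
    (hN : ∀ Q M : L, IsPrimeElement Q → IsPrimeElement M → Q < M → Q ≤ loc M ⊥) :
    IsZPILattice L := by
  classical
  intro a
  obtain ⟨u, hu, hu0⟩ := hF ⊥ (isPrincipalElement_bot.isCompactElement hC)
  have hy (p : L) : ∃ y, IsCompactElement y ∧ y ≤ a ∧ (¬ a ≤ p → ¬ y ≤ p) := by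
    by_cases h : a ≤ p
    · exact ⟨⊥, isPrincipalElement_bot.isCompactElement hC, bot_le, fun h' => absurd h h'⟩
    · obtain ⟨y, hy, hya, hyp⟩ := hP.exists_not_le h
      exact ⟨y, hy.isCompactElement hC, hya, fun _ => hyp⟩
  have hz (M : L) : ∃ z, IsCompactElement z ∧ z ≤ a ∧ (IsPrimeElement M → a ≤ loc M z) := by
    by_cases h : IsPrimeElement M
    · obtain ⟨z, hz, hza, haz⟩ :=
        exists_isPrincipalElement_le_loc hC hP hF h (fun Q hQ hQM => hN Q M hQ h hQM) a
      exact ⟨z, hz.isCompactElement hC, hza, fun _ => haz⟩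
    · exact ⟨⊥, isPrincipalElement_bot.isCompactElement hC, bot_le, fun h' => absurd h' h⟩
  choose y hyc hya hyp using hy
  choose z hzc hza haz using hz
  -- `b` lies below the same factors of `⊥` as `a`; outside finitely many primes this suffices for
  -- `a` and `b` to agree locally, and those primes are dealt with by enlarging `b` to `b'`.
  set b := u.toFinset.sup y with hb
  have hbc : IsCompactElement b := CompleteLattice.isCompactElement_finsetSup _ fun p _ => hyc p
  obtain ⟨v, hv, hvb⟩ := hF b hbc
  set b' := b ⊔ (u + v).toFinset.sup z with hb'
  have hb'c : IsCompactElement b' := isCompactElement_sup hbc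
    (CompleteLattice.isCompactElement_finsetSup _ fun p _ => hzc p)
  suffices a = b' from this ▸ hF b' hb'c
  refine le_antisymm ?_ (sup_le (Finset.sup_le fun p _ => hya p) (Finset.sup_le fun p _ => hza p))
  refine hP.le_of_forall fun x hx hxa => le_of_forall_isPrimeElement hC fun M hM => ?_
  refine hM.exists_mul_le_of_le_loc (hx.isCompactElement hC) (hxa.trans ?_)
  by_cases hMF : M ∈ u + v
  · exact (haz M hM).trans (loc_mono M
      ((Finset.le_sup (f := z) (Multiset.mem_toFinset.2 hMF)).trans le_sup_right))
  have hMu : M ∉ u := fun h => hMF (Multiset.mem_add.2 (Or.inl h))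
  have hMv : M ∉ v := fun h => hMF (Multiset.mem_add.2 (Or.inr h))
  obtain ⟨p, hp, hpM⟩ := hM.exists_mem_le_of_prod_le (hu0.trans_le bot_le)
  have hp' := hu p hp
  have hpM' : p < M := lt_of_le_of_ne hpM fun h => hMu (h ▸ hp)
  by_cases hap : a ≤ p
  · exact hap.trans ((hN p M hp' hM hpM').trans (loc_mono M bot_le))
  · have hbp : ¬ b ≤ p := fun h =>
      hyp p hap ((Finset.le_sup (f := y) (Multiset.mem_toFinset.2 hp)).trans h)
    have hbM : ¬ b ≤ M := fun h => by
      obtain ⟨q, hq, hqM⟩ := hM.exists_mem_le_of_prod_le (hvb.trans_le h)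
      have hqM' : q < M := lt_of_le_of_ne hqM fun h => hMv (h ▸ hq)
      refine hbp (hvb.symm.trans_le ((prod_le_of_mem hq).trans ?_))
      exact (hN q M (hv q hq) hM hqM').trans ((loc_mono M bot_le).trans (hp'.loc_le hpM))
    exact le_loc_of_mul_le hbM ((mul_le_right a b).trans le_sup_left)

/-! ### ZPI-lattices -/

lemma IsZPILattice.separatesPrimes {L : Type*} [CommMonoid L] [CompleteLattice L]
    (hP : IsPrincipallyGenerated L) (hZ : IsZPILattice L) : SeparatesPrimes L := by
  intro P M hPp hM hPM
  obtain ⟨y, hy, hyM, hyP⟩ := hP.exists_not_le hPM.not_ge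
  exact ⟨P, y, le_rfl, hy, hyM, hyP, hZ _, fun E _ h _ => le_sup_left.trans h⟩

/-! ### Prüfer lattices -/

/-- In a Prüfer lattice, the primes below a given prime form a chain. -/
lemma IsPruferLattice.le_or_le (hC : IsCLattice L) (hP : IsPrincipallyGenerated L)
    (hPr : IsPruferLattice L) {P E M : L} (hPp : IsPrimeElement P) (hE : IsPrimeElement E)
    (hM : IsPrimeElement M) (hPM : P ≤ M) (hEM : E ≤ M) : P ≤ E ∨ E ≤ P := by
  by_contra! h
  obtain ⟨x, hx, hxP, hxE⟩ := hP.exists_not_le h.1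
  obtain ⟨y, hy, hyE, hyP⟩ := hP.exists_not_le h.2
  have he := hPr _ (isCompactElement_sup (hx.isCompactElement hC) (hy.isCompactElement hC))
  set e := x ⊔ y
  have hxe : colon x e * e = x := he.1.eq_colon_mul le_sup_left
  have hye : colon y e * e = y := he.1.eq_colon_mul le_sup_right
  -- Locally at `M`, one of `x` and `y` divides the other.
  have h1 : 1 ≤ colon ⊥ e ⊔ (colon x e ⊔ colon y e) := by
    apply he.le_colon_sup
    rw [one_mul, bot_sup_eq, Quantale.sup_mul_distrib, hxe, hye]
  refine hM.one_not_le (h1.trans (sup_le ?_ (sup_le ?_ ?_)))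
  · exact (hPp.le_of_mul_le ((colon_mul_le ⊥ e).trans bot_le)
      fun h' => hyP (le_sup_right.trans h')).trans hPM
  · exact (hPp.le_of_mul_le ((colon_mul_le x e).trans hxP)
      fun h' => hyP (le_sup_right.trans h')).trans hPM
  · exact (hE.le_of_mul_le ((colon_mul_le y e).trans hyE)
      fun h' => hxE (le_sup_left.trans h')).trans hEM

lemma IsPruferLattice.separatesPrimes (hC : IsCLattice L) (hP : IsPrincipallyGenerated L)
    (hPr : IsPruferLattice L)
    (hF : ∀ a : L, IsCompactElement a → IsFiniteProductOf IsPrimeElement a) :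
    SeparatesPrimes L := by
  intro P M hPp hM hPM
  obtain ⟨y, hy, hyM, hyP⟩ := hP.exists_not_le hPM.not_ge
  refine ⟨⊥, y, bot_le, hy, hyM, hyP, ?_, fun E hE hyE hEM => ?_⟩
  · rw [bot_sup_eq]
    exact hF y (hy.isCompactElement hC)
  · exact (hPr.le_or_le hC hP hPp hE hM hPM.le hEM).resolve_right fun h =>
      hyP (le_sup_right.trans (hyE.trans h))

/-- A nonprime OA-element `x` forces the lattice to be quasi-local: there is a greatest element
`m ≠ 1`, and `m * m ≤ x`. -/
lemma IsOAElement.exists_prime_forall_le {x : L} (hx : IsOAElement x) (hxp : ¬ IsPrimeElement x) :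
    ∃ m : L, IsPrimeElement m ∧ (∀ a, a ≠ 1 → a ≤ m) ∧ m * m ≤ x := by
  have h : ∃ a b : L, a * b ≤ x ∧ ¬ a ≤ x ∧ ¬ b ≤ x := by
    by_contra! h
    exact hxp ⟨hx.1, fun a b hab => or_iff_not_imp_left.2 (h a b hab)⟩
  obtain ⟨a, b, hab, ha, hb⟩ := h
  have ha1 : a ≠ 1 := by rintro rfl; exact hb (by simpa using hab)
  have hb1 : b ≠ 1 := by rintro rfl; exact ha (by simpa using hab)
  have hmul (s : L) (hs : s ≠ 1) : s * a ≤ x :=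
    (hx.2 s a b hs ha1 hb1 (by rw [mul_assoc]; exact (mul_le_right _ _).trans hab)).resolve_right hb
  let m : L := sSup {s | s ≠ 1}
  have hma : m * a ≤ x := by
    rw [IsQuantale.sSup_mul_distrib]
    exact iSup₂_le hmul
  have hm1 : m ≠ 1 := fun h => ha (by simpa [h] using hma)
  have hm (s : L) (hs : s ≠ 1) : s ≤ m := le_sSup hs
  refine ⟨m, ⟨lt_of_le_of_ne (le_one' m) hm1, fun c d hcd => ?_⟩, hm, ?_⟩
  · by_contra! h
    have hc : c = 1 := by_contra fun hc => h.1 (hm c hc)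
    have hd : d = 1 := by_contra fun hd => h.2 (hm d hd)
    rw [hc, hd, one_mul] at hcd
    exact hm1 (le_antisymm (le_one' m) hcd)
  · exact (hx.2 m m a hm1 hm1 ha1
      (by rw [mul_assoc]; exact (mul_le_right _ _).trans hma)).resolve_right ha

/-- In a Prüfer lattice every OA-element is either prime or the square of a prime. -/
lemma IsPruferLattice.isFiniteProductOf_of_isOAElement (hC : IsCLattice L)
    (hP : IsPrincipallyGenerated L) (hPr : IsPruferLattice L) {x : L} (hx : IsOAElement x) :
    IsFiniteProductOf IsPrimeElement x := by
  by_cases hxp : IsPrimeElement x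
  · exact .of_apply hxp
  obtain ⟨m, hm, hmax, hmm⟩ := hx.exists_prime_forall_le hxp
  have hxm : x ≤ m := hmax x hx.1.ne
  have hne : x ≠ m := fun h => hxp (h ▸ hm)
  have hmm' : ¬ m ≤ m * m := fun h => hne (le_antisymm hxm (h.trans hmm))
  -- A principal element below `m` but not below `m * m` must be `m` itself.
  obtain ⟨z, hz, hzm, hzmm⟩ := hP.exists_not_le hmm'
  have hmz : m ≤ z := by
    refine hP.le_of_forall fun a ha ham => ?_
    have he := hPr _ (isCompactElement_sup (ha.isCompactElement hC) (hz.isCompactElement hC))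
    have hze : colon z (a ⊔ z) * (a ⊔ z) = z := he.1.eq_colon_mul le_sup_right
    have h1 : colon z (a ⊔ z) = 1 := by
      by_contra h
      exact hzmm (hze.symm.trans_le (mul_le_mul' (hmax _ h) (sup_le ham hzm)))
    rw [h1, one_mul] at hze
    exact le_sup_left.trans_eq hze
  obtain rfl : z = m := le_antisymm hzm hmz
  have hxz : colon x z * z = x := hz.1.eq_colon_mul hxm
  have hcol : colon x z ≠ 1 := fun h => hne (by rw [← hxz, h, one_mul])
  have hxzz : x = z * z :=
    le_antisymm (hxz.symm.trans_le (mul_le_mul_left (hmax _ hcol) z)) hmm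
  rw [hxzz]
  exact (IsFiniteProductOf.of_apply hm).mul (.of_apply hm)

end MultLattice

theorem theorem4p14 (L : Type*) [CommMonoid L] [CompleteLattice L] [IsMultiplicativeLattice L]
    (hC : MultLattice.IsCLattice L) (hP : MultLattice.IsPrincipallyGenerated L) :
    List.TFAE [MultLattice.IsZPILattice L,
      MultLattice.IsPruferLattice L ∧ MultLattice.IsOAFL L,
      MultLattice.IsPruferLattice L ∧ MultLattice.IsPOAFL L] := by
  tfae_have 1 → 2 := fun hZ => by
    have hF : ∀ a : L, IsCompactElement a →
        MultLattice.IsFiniteProductOf MultLattice.IsPrimeElement a := fun a _ => hZ a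
    refine ⟨fun e he => MultLattice.isPrincipalElement_of_locally hC he fun M hM => ?_,
      fun a => (hZ a).trans fun p hp => .of_apply hp.isOAElement⟩
    exact MultLattice.exists_isPrincipalElement_le_loc hC hP hF hM
      (fun Q hQ hQM => (hZ.separatesPrimes hP).le_loc_bot hC hP hF hQ hM hQM) e
  tfae_have 2 → 3 := fun ⟨hPr, hO⟩ => ⟨hPr, fun a _ => hO a⟩
  tfae_have 3 → 1 := fun ⟨hPr, hO⟩ => by
    have hF : ∀ a : L, IsCompactElement a →
        MultLattice.IsFiniteProductOf MultLattice.IsPrimeElement a := fun a ha =>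
      (hO a (hPr a ha)).trans fun x hx => hPr.isFiniteProductOf_of_isOAElement hC hP hx
    exact MultLattice.isZPILattice_of_forall_isCompactElement hC hP hF fun Q M hQ hM hQM =>
      (hPr.separatesPrimes hC hP hF).le_loc_bot hC hP hF hQ hM hQM
  tfae_finish
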